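/- Let $m=(m_0,m_1,\dots)$ be a sequence of integers with $m_k\ge 2$ and $\sup_k m_k<\infty$. Let $G_m=\prod_{k\ge0}\mathbb{Z}/m_k\mathbb{Z}$ be the corresponding bounded Vilenkin group, and let $\mu$ be the product of the uniform probability measures on the factors, i.e. the normalized Haar measure. Put $M_0=1$, $M_{k+1}=m_kM_k$, and write each $n\in\mathbb{N}$ uniquely as $n=\sum_k n_kM_k$ with $n_k\in\{0,\dots,m_k-1\}$. Let $r_k(x)=\exp(2\pi i x_k/m_k)$ and $\psi_n(x)=\prod_k r_k(x)^{n_k}$ for $x=(x_k)_k\in G_m$. For $f\in L_1(G_m)$ (complex valued) set $$\hat f(k)=\int_{G_m} f\,\overline{\psi_k}\,d\mu,\qquad S_nf=\sum_{k=0}^{n-1}\hat f(k)\psi_k,\qquad \sigma_n^{\psi}f=\frac1n\sum_{k=0}^{n-1}S_kf\quad(n\ge1),\qquad \sigma^{*,\psi}f=\sup_{n\ge1}|\sigma_n^{\psi}f|.$$ Then $\sigma^{*,\psi}$ is of weak type $(1,1)$: there is a finite constant $C$, depending only on $m$, such that for all $f\in L_1(G_m)$ $$\sup_{y>0}\,y\,\mu\{x\in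 G_m:\sigma^{*,\psi}f(x)>y\}\le C\,\|f\|_1 .$$ -/

import Mathlib

open MeasureTheory
open scoped ENNReal

namespace Vilenkin

/-- The Vilenkin group `G_m`: the complete direct product of the cyclic groups `ℤ / m_k ℤ`,
with its coordinatewise addition, product topology and product σ-algebra. -/
abbrev Grp (m : ℕ → ℕ) : Type := (k : ℕ) → ZMod (m k)

/-- The uniform measure `μ_k({j}) = 1 / m_k` on the `k`-th factor. -/
noncomputable def factorMeasure (m : ℕ → ℕ) (k : ℕ) : Measure (ZMod (m k)) :=
  ((m k : ℝ≥0∞))⁻¹ • Measure.count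

/-- The direct product of the uniform measures, i.e. the normalized Haar measure of `G_m`. -/
noncomputable def haar (m : ℕ → ℕ) : Measure (Grp m) :=
  Measure.infinitePi (factorMeasure m)

/-- The generalized powers `M_0 = 1`, `M_{k+1} = m_k M_k`. -/
def genPow (m : ℕ → ℕ) : ℕ → ℕ
  | 0 => 1
  | k + 1 => m k * genPow m k

/-- The `k`-th digit `n_k ∈ {0, …, m_k - 1}` in the expansion `n = ∑_k n_k M_k`. -/
def digit (m : ℕ → ℕ) (n k : ℕ) : ℕ := n / genPow m k % m k

/-- The generalized Rademacher function `r_k(x) = exp (2 π i x_k / m_k)`. -/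
noncomputable def rademacher (m : ℕ → ℕ) (k : ℕ) (x : Grp m) : ℂ :=
  Complex.exp (2 * Real.pi * Complex.I * ((x k).val : ℂ) / (m k : ℂ))

/-- The Vilenkin function `ψ_n = ∏_k r_k ^ n_k`. If all `m_k ≥ 2`, only factors with `k < n` can
differ from `1`, see `digit_eq_zero`. -/
noncomputable def psi (m : ℕ → ℕ) (n : ℕ) (x : Grp m) : ℂ :=
  ∏ k ∈ Finset.range n, rademacher m k x ^ digit m n k

/-- The Fourier coefficient `∫ f \overline{ψ_k} dμ`. -/
noncomputable def fourierCoeff (m : ℕ → ℕ) (f : Grp m → ℂ) (k : ℕ) : ℂ :=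
  ∫ x, f x * (starRingEnd ℂ) (psi m k x) ∂(haar m)

/-- The partial sum `S_n f = ∑_{k < n} \hat f(k) ψ_k`. -/
noncomputable def partialSum (m : ℕ → ℕ) (f : Grp m → ℂ) (n : ℕ) (x : Grp m) : ℂ :=
  ∑ k ∈ Finset.range n, fourierCoeff m f k * psi m k x

/-- The Fejér mean `σ_n f = (1 / n) ∑_{k < n} S_k f`. -/
noncomputable def fejerMean (m : ℕ → ℕ) (f : Grp m → ℂ) (n : ℕ) (x : Grp m) : ℂ :=
  (1 / (n : ℂ)) * ∑ k ∈ Finset.range n, partialSum m f k x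

/-- The maximal operator `σ^* f = sup_{n ≥ 1} |σ_n f|`, with values in `[0, ∞]`. -/
noncomputable def maximalFejer (m : ℕ → ℕ) (f : Grp m → ℂ) (x : Grp m) : ℝ≥0∞ :=
  ⨆ (n : ℕ) (_ : 1 ≤ n), ‖fejerMean m f n x‖ₑ

theorem lt_genPow {m : ℕ → ℕ} (hm : ∀ k, 2 ≤ m k) (k : ℕ) : k < genPow m k := by
  induction k with
  | zero => simp [genPow]
  | succ k ih =>
    have h : 2 * genPow m k ≤ m k * genPow m k := Nat.mul_le_mul_right _ (hm k)
    simp only [genPow]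
    omega

theorem digit_eq_zero {m : ℕ → ℕ} (hm : ∀ k, 2 ≤ m k) {n k : ℕ} (h : n ≤ k) :
    digit m n k = 0 := by
  have h1 : n < genPow m k := lt_of_le_of_lt h (lt_genPow hm k)
  simp [digit, Nat.div_eq_of_lt h1]

/-- The digits are those of the generalized number system based on `m`. -/
theorem sum_digit_mul_genPow {m : ℕ → ℕ} (hm : ∀ k, 2 ≤ m k) (n : ℕ) :
    ∑ k ∈ Finset.range n, digit m n k * genPow m k = n := by
  have key : ∀ K, ∑ k ∈ Finset.range K, digit m n k * genPow m k = n % genPow m K := by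
    intro K
    induction K with
    | zero => simp [genPow, Nat.mod_one]
    | succ K ih =>
      rw [Finset.sum_range_succ, ih, genPow, mul_comm (m K), Nat.mod_mul, digit, mul_comm]
  rw [key, Nat.mod_eq_of_lt (lt_genPow hm n)]

end Vilenkin

/-! ### Growth of the generalized powers. -/

namespace Vilenkin

/-! The mean `σ_N f(x)` is the integral of `f(t)` against the Fejér kernel at `w_k = r_k(x) * conj
r_k(t)`. Peeling off the leading digits of `N` (`norm_fejerSum_le`) bounds `|N K_N|`, for `M_n ≤ N <
M_{n+1}`, by a constant times the sum over `j ≤ s ≤ n` of `M_s M_j`, restricted to those `t` that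
agree with `x` below `s` except perhaps at `j`. Since `∑_{s ≤ n} M_s ≤ 2N`, the maximal function is
at most a constant times the supremum over `s` of the positive operators `nearMean` applied to `|f|`
(`enorm_fejerMean_le`).

No cancellation is needed from here on: a stopping argument gives the weak type bound. Stop a point
at the first level where the conditional expectation of `|f|` exceeds `y`. Doob's inequality
disposes of the `x` that are ever stopped. For any other `x`, the points `t` of its `(s, j)`
neighbourhood share its first `j` coordinates, so they are not stopped by level `j`. The mass not
stopped by level `s` contributes `O(y)`, because `∑_{j ≤ s} M_j ≤ 2 M_s` (`nearMean_le`). The mass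
stopped after level `j` but by level `s` contributes a function of `L_1` norm `O(‖f‖_1)`: a point
stopped at level `k` enters only for `j < k ≤ s`, and `M_j / M_s` summed over these pairs is at most
`2` (`tsum_stopped_le`). Markov's inequality finishes. -/

theorem genPow_pos {m : ℕ → ℕ} (hm : ∀ k, 2 ≤ m k) (k : ℕ) : 0 < genPow m k :=
  (Nat.zero_le k).trans_lt (lt_genPow hm k)

theorem genPow_dvd {m : ℕ → ℕ} {k n : ℕ} (h : k ≤ n) : genPow m k ∣ genPow m n := by
  induction n, h using Nat.le_induction with
  | base => exact dvd_rfl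
  | succ n _ ih => exact ih.trans (Dvd.intro_left _ rfl)

theorem genPow_mono {m : ℕ → ℕ} (hm : ∀ k, 2 ≤ m k) : Monotone (genPow m) :=
  fun _ n h => Nat.le_of_dvd (genPow_pos hm n) (genPow_dvd h)

theorem two_mul_genPow_le {m : ℕ → ℕ} (hm : ∀ k, 2 ≤ m k) (k : ℕ) :
    2 * genPow m k ≤ genPow m (k + 1) :=
  Nat.mul_le_mul_right _ (hm k)

theorem sum_genPow_le {m : ℕ → ℕ} (hm : ∀ k, 2 ≤ m k) (n : ℕ) :
    ∑ k ∈ Finset.range n, genPow m k ≤ genPow m n := by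
  induction n with
  | zero => simp
  | succ n ih =>
    rw [Finset.sum_range_succ]
    have := two_mul_genPow_le hm n
    omega

theorem exists_genPow_le_lt {m : ℕ → ℕ} (hm : ∀ k, 2 ≤ m k) {N : ℕ} (hN : 1 ≤ N) :
    ∃ n, genPow m n ≤ N ∧ N < genPow m (n + 1) := by
  have hex : ∃ k, N < genPow m k := ⟨N, lt_genPow hm N⟩
  obtain ⟨n, hn⟩ : ∃ n, Nat.find hex = n + 1 := by
    refine Nat.exists_eq_succ_of_ne_zero fun h => ?_
    have := Nat.find_spec hex
    rw [h] at this
    simp only [genPow] at this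
    omega
  refine ⟨n, not_lt.1 (Nat.find_min hex (by omega)), ?_⟩
  rw [← hn]
  exact Nat.find_spec hex

/-! ### Block recursions for the characters and kernels. -/

/-- The character `∏ w_k ^ n_k` with values `w_k` in place of the Rademacher functions. -/
noncomputable def character (m : ℕ → ℕ) (w : ℕ → ℂ) (n : ℕ) : ℂ :=
  ∏ k ∈ Finset.range n, w k ^ digit m n k

/-- The Dirichlet kernel `D_n`. -/
noncomputable def dirichlet (m : ℕ → ℕ) (w : ℕ → ℂ) (n : ℕ) : ℂ :=
  ∑ k ∈ Finset.range n, character m w k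

/-- The unnormalized Fejér kernel `n K_n = ∑_{k < n} D_k`. -/
noncomputable def fejerSum (m : ℕ → ℕ) (w : ℕ → ℂ) (n : ℕ) : ℂ :=
  ∑ k ∈ Finset.range n, dirichlet m w k

theorem character_eq_prod {m : ℕ → ℕ} (hm : ∀ k, 2 ≤ m k) (w : ℕ → ℂ) {n K : ℕ}
    (hn : n < genPow m K) : character m w n = ∏ k ∈ Finset.range K, w k ^ digit m n k := by
  have h1 : ∀ k, n ≤ k → w k ^ digit m n k = 1 := fun k hk => by
    rw [digit_eq_zero hm hk, pow_zero]
  have h2 : ∀ k, K ≤ k → w k ^ digit m n k = 1 := fun k hk => by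
    rw [digit, Nat.div_eq_of_lt (hn.trans_le (genPow_mono hm hk)), Nat.zero_mod, pow_zero]
  rw [character]
  rcases le_total n K with h | h
  · exact Finset.prod_subset (Finset.range_mono h) fun k _ hk => h1 k (by simpa using hk)
  · exact (Finset.prod_subset (Finset.range_mono h) fun k _ hk => h2 k (by simpa using hk)).symm

theorem character_block {m : ℕ → ℕ} (hm : ∀ k, 2 ≤ m k) (w : ℕ → ℂ) {n a r : ℕ}
    (ha : a < m n) (hr : r < genPow m n) :
    character m w (a * genPow m n + r) = w n ^ a * character m w r := by
  have hpos := genPow_pos hm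
  have hlt : a * genPow m n + r < genPow m (n + 1) := by
    have : (a + 1) * genPow m n ≤ m n * genPow m n := Nat.mul_le_mul_right _ ha
    simp only [genPow]
    linarith
  rw [character_eq_prod hm w hlt, character_eq_prod hm w hr, Finset.prod_range_succ, mul_comm]
  congr 1
  · congr 1
    rw [digit, mul_comm, Nat.mul_add_div (hpos n), Nat.div_eq_of_lt hr, add_zero,
      Nat.mod_eq_of_lt ha]
  · refine Finset.prod_congr rfl fun k hk => ?_
    obtain ⟨q, hq⟩ := genPow_dvd (m := m) (Finset.mem_range.1 hk)
    congr 1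
    rw [Nat.succ_eq_add_one] at hq
    have h : a * genPow m n + r = genPow m k * (m k * (a * q)) + r := by
      rw [hq, genPow]; ring
    rw [digit, h, Nat.mul_add_div (hpos k), Nat.mul_add_mod, digit]

/-- The indices summed are strictly below the end point, so `r = M_n` is admissible; this lets whole
blocks be stacked by induction on `a`. -/
theorem dirichlet_block {m : ℕ → ℕ} (hm : ∀ k, 2 ≤ m k) (w : ℕ → ℂ) {n a r : ℕ}
    (ha : a < m n) (hr : r ≤ genPow m n) :
    dirichlet m w (a * genPow m n + r) =
      dirichlet m w (a * genPow m n) + w n ^ a * dirichlet m w r := by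
  rw [dirichlet, Finset.sum_range_add, dirichlet, dirichlet, Finset.mul_sum]
  congr 1
  exact Finset.sum_congr rfl fun i hi =>
    character_block hm w ha ((Finset.mem_range.1 hi).trans_le hr)

theorem dirichlet_mul_genPow {m : ℕ → ℕ} (hm : ∀ k, 2 ≤ m k) (w : ℕ → ℂ) {n a : ℕ}
    (ha : a ≤ m n) :
    dirichlet m w (a * genPow m n) =
      (∑ c ∈ Finset.range a, w n ^ c) * dirichlet m w (genPow m n) := by
  induction a with
  | zero => simp [dirichlet]
  | succ a ih =>
    rw [add_mul, one_mul, dirichlet_block hm w ha le_rfl, ih (by omega), Finset.sum_range_succ,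
      add_mul]

/-- Each of the `r` Dirichlet kernels in the last, partial block contains a full copy of `D_{a
M_n}`, whence the middle term. -/
theorem fejerSum_block {m : ℕ → ℕ} (hm : ∀ k, 2 ≤ m k) (w : ℕ → ℂ) {n a r : ℕ}
    (ha : a < m n) (hr : r ≤ genPow m n) :
    fejerSum m w (a * genPow m n + r) = fejerSum m w (a * genPow m n) +
      (r * dirichlet m w (a * genPow m n) + w n ^ a * fejerSum m w r) := by
  rw [fejerSum, Finset.sum_range_add, fejerSum, fejerSum, Finset.mul_sum]
  congr 1
  rw [Finset.sum_congr rfl fun i hi =>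
    dirichlet_block hm w ha ((Finset.mem_range.1 hi).le.trans hr), Finset.sum_add_distrib]
  simp

theorem sum_pow_of_pow_eq_one {z : ℂ} {k : ℕ} (h : z ^ k = 1) :
    ∑ c ∈ Finset.range k, z ^ c = if z = 1 then (k : ℂ) else 0 := by
  split_ifs with hz
  · simp [hz]
  · rw [geom_sum_eq hz, h, sub_self, zero_div]

/-! ### Indicators with one exempt coordinate, and the majorant. -/

open Classical in
/-- The indicator of `w_i = 1` for all `i < s`, `i ≠ j`. -/
noncomputable def offInd (w : ℕ → ℂ) (s j : ℕ) : ℝ :=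
  if ∀ i < s, i ≠ j → w i = 1 then 1 else 0

theorem offInd_nonneg (w : ℕ → ℂ) (s j : ℕ) : 0 ≤ offInd w s j := by
  unfold offInd; split_ifs <;> simp

theorem offInd_succ_self (w : ℕ → ℂ) (s : ℕ) : offInd w (s + 1) s = offInd w s s := by
  unfold offInd
  congr 1
  refine propext ⟨fun h i hi => h i (by omega), fun h i hi hne => h i (by omega) hne⟩

theorem offInd_self (w : ℕ → ℂ) {s j : ℕ} (h : s ≤ j) : offInd w s j = offInd w s s := by
  unfold offInd
  congr 1
  exact propext ⟨fun H i hi _ => H i hi (by omega), fun H i hi _ => H i hi (by omega)⟩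

theorem offInd_succ (w : ℕ → ℂ) {s j : ℕ} (h : s ≠ j) :
    offInd w (s + 1) j = offInd w s j * (if w s = 1 then 1 else 0) := by
  unfold offInd
  have : (∀ i < s + 1, i ≠ j → w i = 1) ↔ (∀ i < s, i ≠ j → w i = 1) ∧ w s = 1 :=
    ⟨fun H => ⟨fun i hi => H i (by omega), H s (by omega) h⟩, fun H i hi hne => by
      rcases Nat.lt_succ_iff_lt_or_eq.1 hi with hi | rfl
      · exact H.1 i hi hne
      · exact H.2⟩
  by_cases h1 : ∀ i < s, i ≠ j → w i = 1 <;> by_cases h2 : w s = 1 <;> simp only [this, h1, h2] <;>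
    simp

/-- The majorant `∑_{j ≤ s} M_j M_s 1{w_i = 1 for i < s, i ≠ j}`. -/
noncomputable def majorant (m : ℕ → ℕ) (w : ℕ → ℂ) (s : ℕ) : ℝ :=
  ∑ j ∈ Finset.range (s + 1), (genPow m j : ℝ) * genPow m s * offInd w s j

theorem majorant_nonneg (m : ℕ → ℕ) (w : ℕ → ℂ) (s : ℕ) : 0 ≤ majorant m w s :=
  Finset.sum_nonneg fun _ _ => mul_nonneg (by positivity) (offInd_nonneg _ _ _)

theorem le_majorant (m : ℕ → ℕ) (w : ℕ → ℂ) (s : ℕ) :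
    (genPow m s : ℝ) * genPow m s * offInd w s s ≤ majorant m w s :=
  Finset.single_le_sum (f := fun j => (genPow m j : ℝ) * genPow m s * offInd w s j)
    (fun _ _ => mul_nonneg (by positivity) (offInd_nonneg _ _ _)) (Finset.self_mem_range_succ s)

/-! ### Pointwise bounds for the Fejér kernels. -/

section Bounds

variable {m : ℕ → ℕ} {w : ℕ → ℂ} {B : ℕ}

theorem dirichlet_genPow (hm : ∀ k, 2 ≤ m k) (hw : ∀ k, w k ^ m k = 1) (n : ℕ) :
    dirichlet m w (genPow m n) = (genPow m n : ℂ) * (offInd w n n : ℂ) := by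
  induction n with
  | zero => simp [dirichlet, genPow, character, offInd]
  | succ n ih =>
    have h1 : offInd w (n + 1) (n + 1) = offInd w n n * (if w n = 1 then 1 else 0) := by
      rw [offInd_succ w n.lt_succ_self.ne, offInd_self w n.le_succ]
    rw [genPow, dirichlet_mul_genPow hm w le_rfl, ih, sum_pow_of_pow_eq_one (hw n), h1]
    split_ifs <;> push_cast <;> ring

theorem norm_eq_one_of_pow (hm : ∀ k, 2 ≤ m k) (hw : ∀ k, w k ^ m k = 1) (k : ℕ) : ‖w k‖ = 1 :=
  Complex.norm_eq_one_of_pow_eq_one (hw k) (by have := hm k; omega)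

theorem norm_dirichlet_mul_genPow_le (hm : ∀ k, 2 ≤ m k) (hw : ∀ k, w k ^ m k = 1) {n a : ℕ}
    (ha : a ≤ m n) :
    ‖dirichlet m w (a * genPow m n)‖ ≤ a * (genPow m n * offInd w n n) := by
  rw [dirichlet_mul_genPow hm w ha, dirichlet_genPow hm hw, norm_mul, norm_mul,
    Complex.norm_natCast, Complex.norm_real, Real.norm_of_nonneg (offInd_nonneg _ _ _)]
  refine mul_le_mul_of_nonneg_right ((norm_sum_le _ _).trans ?_)
    (mul_nonneg (by positivity) (offInd_nonneg _ _ _))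
  simp [norm_eq_one_of_pow hm hw]

theorem fejerSum_mul_genPow (hm : ∀ k, 2 ≤ m k) (w : ℕ → ℂ) {n a : ℕ} (ha : a ≤ m n) :
    fejerSum m w (a * genPow m n) =
      (∑ b ∈ Finset.range a, genPow m n * dirichlet m w (b * genPow m n)) +
        (∑ b ∈ Finset.range a, w n ^ b) * fejerSum m w (genPow m n) := by
  induction a with
  | zero => simp [fejerSum]
  | succ a ih =>
    rw [add_mul, one_mul, fejerSum_block hm w ha le_rfl, ih (by omega), Finset.sum_range_succ,
      Finset.sum_range_succ]
    ring

theorem norm_sum_dirichlet_le (hm : ∀ k, 2 ≤ m k) (hB : ∀ k, m k ≤ B)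
    (hw : ∀ k, w k ^ m k = 1) {n a : ℕ} (ha : a ≤ m n) :
    ‖∑ b ∈ Finset.range a, genPow m n * dirichlet m w (b * genPow m n)‖ ≤
      B ^ 2 * (genPow m n * genPow m n * offInd w n n) := by
  have h0 := offInd_nonneg w n n
  have haB : (a : ℝ) ≤ B := by exact_mod_cast ha.trans (hB n)
  calc _ ≤ ∑ b ∈ Finset.range a, (B : ℝ) * (genPow m n * genPow m n * offInd w n n) := by
        refine norm_sum_le_of_le _ fun b hb => ?_
        have hb := Finset.mem_range.1 hb
        have hbB : (b : ℝ) ≤ B := by exact_mod_cast hb.le.trans (ha.trans (hB n))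
        rw [norm_mul, Complex.norm_natCast]
        calc _ ≤ (genPow m n : ℝ) * (b * (genPow m n * offInd w n n)) := by
              gcongr; exact norm_dirichlet_mul_genPow_le hm hw (by omega)
          _ ≤ (genPow m n : ℝ) * (B * (genPow m n * offInd w n n)) := by gcongr
          _ = _ := by ring
    _ = a * (B * (genPow m n * genPow m n * offInd w n n)) := by simp
    _ ≤ B * (B * (genPow m n * genPow m n * offInd w n n)) := by gcongr
    _ = _ := by ring

/-- Passing from `n` to `n + 1` multiplies the old kernel by a full geometric sum, equal to `m_n
1{w_n = 1}`: the old terms survive with one more coordinate forced. The added Dirichlet kernels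
leave `w_n` free and create the new term `j = n`; this is where exempt coordinates come from. -/
theorem norm_fejerSum_genPow_le_sum (hm : ∀ k, 2 ≤ m k) (hB : ∀ k, m k ≤ B)
    (hw : ∀ k, w k ^ m k = 1) (n : ℕ) :
    ‖fejerSum m w (genPow m n)‖ ≤
      B ^ 2 * ∑ j ∈ Finset.range n, (genPow m j : ℝ) * genPow m n * offInd w n j := by
  induction n with
  | zero => simp [fejerSum, genPow, dirichlet]
  | succ n ih =>
    have hrec : fejerSum m w (genPow m (n + 1)) = _ := fejerSum_mul_genPow hm w (le_refl (m n))
    rw [hrec, sum_pow_of_pow_eq_one (hw n), Finset.sum_range_succ, mul_add, add_comm]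
    refine (norm_add_le _ _).trans (add_le_add ?_ ?_)
    · rw [norm_mul]
      calc _ ≤ (m n * if w n = 1 then 1 else 0 : ℝ) *
            (B ^ 2 * ∑ j ∈ Finset.range n, (genPow m j : ℝ) * genPow m n * offInd w n j) := by
              gcongr
              split_ifs <;> simp
        _ = B ^ 2 * ∑ j ∈ Finset.range n,
            (genPow m j : ℝ) * genPow m (n + 1) * offInd w (n + 1) j := by
              rw [mul_left_comm, Finset.mul_sum]
              congr 1
              refine Finset.sum_congr rfl fun j hj => ?_
              rw [offInd_succ w (Finset.mem_range.1 hj).ne', genPow]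
              push_cast
              ring
    · refine (norm_sum_dirichlet_le hm hB hw le_rfl).trans ?_
      rw [offInd_succ_self]
      have h0 := offInd_nonneg w n n
      have : (genPow m n : ℝ) ≤ genPow m (n + 1) := by exact_mod_cast genPow_mono hm n.le_succ
      gcongr

theorem norm_fejerSum_genPow_le (hm : ∀ k, 2 ≤ m k) (hB : ∀ k, m k ≤ B)
    (hw : ∀ k, w k ^ m k = 1) (n : ℕ) :
    ‖fejerSum m w (genPow m n)‖ ≤ B ^ 2 * majorant m w n := by
  refine (norm_fejerSum_genPow_le_sum hm hB hw n).trans ?_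
  rw [majorant, Finset.sum_range_succ]
  have h0 := offInd_nonneg w n n
  gcongr
  exact le_add_of_nonneg_right (by positivity)

/-- Removing the leading digit costs three terms of size `B^3` times the top majorant: two from the
complete blocks and one from `r D_{a M_n}`. The remainder `r` is handled by induction, as `|w_n^a| =
1`. -/
theorem norm_fejerSum_le (hm : ∀ k, 2 ≤ m k) (hB : ∀ k, m k ≤ B)
    (hw : ∀ k, w k ^ m k = 1) {n N : ℕ} (hN : N < genPow m n) :
    ‖fejerSum m w N‖ ≤ 3 * B ^ 3 * ∑ s ∈ Finset.range n, majorant m w s := by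
  induction n generalizing N with
  | zero =>
    have : N = 0 := by simpa [genPow] using hN
    simp [this, fejerSum]
  | succ n ih =>
    have hpos := genPow_pos hm n
    set a := N / genPow m n with ha_def
    set r := N % genPow m n with hr_def
    have hr : r < genPow m n := Nat.mod_lt _ hpos
    have ha : a < m n := (Nat.div_lt_iff_lt_mul hpos).2 hN
    have hNar : N = a * genPow m n + r := (Nat.div_add_mod' N _).symm
    have haB : (a : ℝ) ≤ B := by exact_mod_cast ha.le.trans (hB n)
    have hrM : (r : ℝ) ≤ genPow m n := by exact_mod_cast hr.le
    have hB1 : (1 : ℝ) ≤ B := by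
      have := (hm 0).trans (hB 0)
      exact_mod_cast (by omega : 1 ≤ B)
    have h0 := offInd_nonneg w n n
    have hq := majorant_nonneg m w n
    have hle := le_majorant m w n
    have hB2 : (B : ℝ) ^ 2 ≤ B ^ 3 := pow_le_pow_right₀ hB1 (by norm_num)
    have hB3 : (B : ℝ) ≤ B ^ 3 := le_self_pow₀ hB1 (by norm_num)
    have e1 : ‖fejerSum m w (a * genPow m n)‖ ≤ B ^ 3 * majorant m w n + B ^ 3 * majorant m w n := by
      rw [fejerSum_mul_genPow hm w ha.le]
      refine (norm_add_le _ _).trans (add_le_add ?_ ?_)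
      · exact (norm_sum_dirichlet_le hm hB hw ha.le).trans (by gcongr)
      · rw [norm_mul]
        calc _ ≤ (B : ℝ) * (B ^ 2 * majorant m w n) := by
              gcongr
              · refine (norm_sum_le _ _).trans ?_
                simpa [norm_eq_one_of_pow hm hw] using haB
              · exact norm_fejerSum_genPow_le hm hB hw n
          _ = _ := by ring
    have e2 : ‖(r : ℂ) * dirichlet m w (a * genPow m n)‖ ≤ B ^ 3 * majorant m w n := by
      rw [norm_mul, Complex.norm_natCast]
      calc _ ≤ (genPow m n : ℝ) * (B * (genPow m n * offInd w n n)) := by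
            gcongr
            exact (norm_dirichlet_mul_genPow_le hm hw ha.le).trans (by gcongr)
        _ = B * (genPow m n * genPow m n * offInd w n n) := by ring
        _ ≤ _ := by gcongr
    have e3 : ‖w n ^ a * fejerSum m w r‖ ≤ 3 * B ^ 3 * ∑ s ∈ Finset.range n, majorant m w s := by
      rw [norm_mul, norm_pow, norm_eq_one_of_pow hm hw, one_pow, one_mul]
      exact ih hr
    rw [hNar, fejerSum_block hm w ha hr.le, Finset.sum_range_succ]
    have t1 := norm_add_le (fejerSum m w (a * genPow m n))
      (r * dirichlet m w (a * genPow m n) + w n ^ a * fejerSum m w r)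
    have t2 := norm_add_le (r * dirichlet m w (a * genPow m n)) (w n ^ a * fejerSum m w r)
    linarith

end Bounds

/-! ### Neighbourhoods with one exempt coordinate: measure and integrals. -/

/-- `x` and `t` have the same first `s` coordinates, except possibly the `j`-th. -/
def near {m : ℕ → ℕ} (s j : ℕ) (x t : Grp m) : Prop := ∀ i < s, i ≠ j → x i = t i

section Near

variable {m : ℕ → ℕ}

theorem near_comm {s j : ℕ} {x t : Grp m} : near s j x t ↔ near s j t x :=
  ⟨fun h i hi hj => (h i hi hj).symm, fun h i hi hj => (h i hi hj).symm⟩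

theorem near.trans {s j : ℕ} {x t z : Grp m} (h : near s j x t) (h' : near s j t z) :
    near s j x z := fun i hi hj => (h i hi hj).trans (h' i hi hj)

theorem near.initial {s j k : ℕ} (hjs : j ≤ s) (hk : k ≤ j) {x t : Grp m} (h : near s j x t) :
    near k k x t := fun i hi _ => h i (by omega) (by omega)

theorem near_update {s j : ℕ} {x t : Grp m} (h : near s j x t) :
    near s s (Function.update x j (t j)) t := fun i hi _ => by
  rcases eq_or_ne i j with rfl | hne
  · simp
  · simpa [hne] using h i hi hne

theorem measurableSet_near (s j : ℕ) :
    MeasurableSet {p : Grp m × Grp m | near s j p.1 p.2} := by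
  have : {p : Grp m × Grp m | near s j p.1 p.2} =
      ⋂ i, ⋂ (_ : i < s), ⋂ (_ : i ≠ j), {p : Grp m × Grp m | p.1 i = p.2 i} := by
    ext p; simp [near]
  rw [this]
  refine .iInter fun i => .iInter fun _ => .iInter fun _ => ?_
  have : Countable (ZMod (m i)) := by
    cases m i
    · exact inferInstanceAs (Countable ℤ)
    · infer_instance
  exact measurableSet_eq_fun (by fun_prop) (by fun_prop)

theorem measurableSet_near_right (s j : ℕ) (x : Grp m) : MeasurableSet {t | near s j x t} :=
  measurable_prodMk_left (measurableSet_near s j)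

theorem isProbabilityMeasure_factorMeasure (hm : ∀ k, 2 ≤ m k) (k : ℕ) :
    IsProbabilityMeasure (factorMeasure m k) := by
  have hk : m k ≠ 0 := by have := hm k; omega
  have : NeZero (m k) := ⟨hk⟩
  constructor
  rw [factorMeasure, Measure.smul_apply, smul_eq_mul, Measure.count_univ]
  simp only [ENat.card_eq_coe_fintype_card, ZMod.card]
  exact ENNReal.inv_mul_cancel (by exact_mod_cast hk) (by simp)

theorem isProbabilityMeasure_haar (hm : ∀ k, 2 ≤ m k) : IsProbabilityMeasure (haar m) := by
  have := isProbabilityMeasure_factorMeasure hm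
  unfold haar
  infer_instance

theorem haar_near (hm : ∀ k, 2 ≤ m k) (s : ℕ) (x : Grp m) :
    haar m {t | near s s x t} = (genPow m s : ℝ≥0∞)⁻¹ := by
  have := isProbabilityMeasure_factorMeasure hm
  have hset : {t | near s s x t} = Set.pi (Finset.range s) fun i => {x i} := by
    ext t
    simp only [near, Set.mem_ofPred_eq, Set.mem_pi, Finset.coe_range, Set.mem_Iio,
      Set.mem_singleton_iff]
    exact ⟨fun h i hi => (h i hi hi.ne).symm, fun h i hi _ => (h i hi).symm⟩
  rw [hset, haar, Measure.infinitePi_pi _ fun i _ => measurableSet_singleton _]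
  clear hset
  induction s with
  | zero => simp [genPow]
  | succ s ih =>
    rw [Finset.prod_range_succ, ih, genPow, Nat.cast_mul, mul_comm (m s : ℝ≥0∞),
      ENNReal.mul_inv (by simp) (by simp), factorMeasure, Measure.smul_apply,
      Measure.count_singleton, smul_eq_mul, mul_one]

/-- The integral of `F` over the points near `x`. -/
noncomputable def nearIntegral (F : Grp m → ℝ≥0∞) (s j : ℕ) (x : Grp m) : ℝ≥0∞ :=
  ∫⁻ t in {t | near s j x t}, F t ∂(haar m)

theorem measurable_indicator_near {F : Grp m → ℝ≥0∞} (hF : Measurable F) (s j : ℕ) :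
    Measurable fun p : Grp m × Grp m => {t | near s j p.1 t}.indicator F p.2 :=
  (hF.comp measurable_snd).indicator (measurableSet_near s j)

theorem nearIntegral_eq (F : Grp m → ℝ≥0∞) (s j : ℕ) (x : Grp m) :
    nearIntegral F s j x = ∫⁻ t, {t | near s j x t}.indicator F t ∂(haar m) :=
  (lintegral_indicator (measurableSet_near_right s j x) F).symm

theorem measurable_nearIntegral (hm : ∀ k, 2 ≤ m k) {F : Grp m → ℝ≥0∞} (hF : Measurable F)
    (s j : ℕ) : Measurable (nearIntegral F s j) := by
  have := isProbabilityMeasure_haar hm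
  simp only [funext fun x => nearIntegral_eq F s j x]
  exact (measurable_indicator_near hF s j).lintegral_prod_right'

theorem nearIntegral_congr {F : Grp m → ℝ≥0∞} {s : ℕ} {x z : Grp m} (h : near s s x z) :
    nearIntegral F s s x = nearIntegral F s s z := by
  have : {t | near s s x t} = {t | near s s z t} :=
    Set.ext fun t => ⟨fun h' => (near_comm.1 h).trans h', fun h' => h.trans h'⟩
  rw [nearIntegral, nearIntegral, this]

theorem nearIntegral_mono {F G : Grp m → ℝ≥0∞} {s j : ℕ} {x : Grp m}
    (h : ∀ t, near s j x t → F t ≤ G t) : nearIntegral F s j x ≤ nearIntegral G s j x :=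
  setLIntegral_mono' (measurableSet_near_right s j x) h

theorem lintegral_nearIntegral (hm : ∀ k, 2 ≤ m k) {F : Grp m → ℝ≥0∞} (hF : Measurable F)
    (s j : ℕ) :
    ∫⁻ x, nearIntegral F s j x ∂(haar m) = ∫⁻ t, F t * haar m {x | near s j t x} ∂(haar m) := by
  have := isProbabilityMeasure_haar hm
  simp only [nearIntegral_eq]
  rw [lintegral_lintegral_swap (measurable_indicator_near hF s j).aemeasurable]
  refine lintegral_congr fun t => ?_
  rw [← lintegral_indicator_const (measurableSet_near_right s j t)]
  refine lintegral_congr fun x => ?_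
  by_cases h : near s j x t
  · rw [Set.indicator_of_mem (by exact h), Set.indicator_of_mem (by exact near_comm.1 h)]
  · rw [Set.indicator_of_notMem (by exact h),
      Set.indicator_of_notMem (by exact fun h' => h (near_comm.1 h'))]

/-- Letting the `j`-th coordinate of `x` run through its `m_j ≤ B` values covers the neighbourhood
by genuine cylinders of level `s`. -/
theorem nearIntegral_le_of_forall {B : ℕ} (hm : ∀ k, 2 ≤ m k) (hB : ∀ k, m k ≤ B)
    {F : Grp m → ℝ≥0∞} {s : ℕ} {c : ℝ≥0∞} (h : ∀ z, nearIntegral F s s z ≤ c) (j : ℕ)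
    (x : Grp m) : nearIntegral F s j x ≤ B * c := by
  have : NeZero (m j) := ⟨by have := hm j; omega⟩
  have hsub : {t | near s j x t} ⊆ ⋃ a : ZMod (m j), {t | near s s (Function.update x j a) t} :=
    fun t ht => Set.mem_iUnion.2 ⟨t j, near_update ht⟩
  calc nearIntegral F s j x
      ≤ ∑' a : ZMod (m j), nearIntegral F s s (Function.update x j a) :=
        (lintegral_mono_set hsub).trans (lintegral_iUnion_le _ _)
    _ ≤ ∑' _ : ZMod (m j), c := ENNReal.tsum_le_tsum fun a => h _
    _ = m j * c := by simp [tsum_fintype, ZMod.card]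
    _ ≤ B * c := by gcongr; exact_mod_cast hB j

theorem haar_near_le {B : ℕ} (hm : ∀ k, 2 ≤ m k) (hB : ∀ k, m k ≤ B) (s j : ℕ) (x : Grp m) :
    haar m {t | near s j x t} ≤ B * (genPow m s : ℝ≥0∞)⁻¹ := by
  have := nearIntegral_le_of_forall hm hB (F := fun _ => 1) (s := s)
    (c := (genPow m s : ℝ≥0∞)⁻¹) (fun z => by simp [nearIntegral, haar_near hm]) j x
  simpa [nearIntegral] using this

end Near

/-! ### Doob's inequality and the stopping argument. -/

section Maximal

variable {m : ℕ → ℕ} {F : Grp m → ℝ≥0∞} {y : ℝ≥0∞}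

/-- The set where the conditional expectation of `F` at level `k` exceeds `y`. -/
def exceed (F : Grp m → ℝ≥0∞) (y : ℝ≥0∞) (k : ℕ) : Set (Grp m) :=
  {z | y < genPow m k * nearIntegral F k k z}

/-- The set where a conditional expectation of `F` at a level `≤ k` exceeds `y`. -/
def stopped (F : Grp m → ℝ≥0∞) (y : ℝ≥0∞) (k : ℕ) : Set (Grp m) :=
  {z | ∃ i ≤ k, z ∈ exceed F y i}

theorem mem_exceed_congr {k : ℕ} {x z : Grp m} (h : near k k x z) :
    x ∈ exceed F y k ↔ z ∈ exceed F y k := by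
  simp only [exceed, Set.mem_ofPred_eq, nearIntegral_congr h]

theorem mem_stopped_congr {k : ℕ} {x z : Grp m} (h : near k k x z) :
    x ∈ stopped F y k ↔ z ∈ stopped F y k :=
  exists_congr fun _ => and_congr_right fun hi => mem_exceed_congr (h.initial le_rfl hi)

theorem stopped_mono : Monotone (stopped F y) :=
  fun _ _ h _ ⟨i, hi, hz⟩ => ⟨i, hi.trans h, hz⟩

theorem measurableSet_exceed (hm : ∀ k, 2 ≤ m k) (hF : Measurable F) (k : ℕ) :
    MeasurableSet (exceed F y k) :=
  measurableSet_lt measurable_const ((measurable_nearIntegral hm hF k k).const_mul _)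

theorem measurableSet_stopped (hm : ∀ k, 2 ≤ m k) (hF : Measurable F) (k : ℕ) :
    MeasurableSet (stopped F y k) := by
  have : stopped F y k = ⋃ i, ⋃ (_ : i ≤ k), exceed F y i := by ext; simp [stopped]
  rw [this]
  exact .iUnion fun i => .iUnion fun _ => measurableSet_exceed hm hF i

theorem genPow_mul_inv (hm : ∀ k, 2 ≤ m k) (k : ℕ) :
    (genPow m k : ℝ≥0∞) * (genPow m k : ℝ≥0∞)⁻¹ = 1 :=
  ENNReal.mul_inv_cancel (by exact_mod_cast (genPow_pos hm k).ne') (by simp)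

/-- By `hcongr`, `D` is a union of cylinders of level `k`, so averaging over these cylinders
preserves the integral of `F` over `D`. -/
theorem mul_haar_le_of_subset_exceed (hm : ∀ k, 2 ≤ m k) (hF : Measurable F) {k : ℕ}
    {D : Set (Grp m)} (hD : MeasurableSet D) (hsub : D ⊆ exceed F y k)
    (hcongr : ∀ x z, near k k x z → x ∈ D → z ∈ D) :
    y * haar m D ≤ ∫⁻ t in D, F t ∂(haar m) := by
  calc y * haar m D = ∫⁻ _ in D, y ∂(haar m) := by simp
    _ ≤ ∫⁻ z in D, genPow m k * nearIntegral F k k z ∂(haar m) :=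
      setLIntegral_mono' hD fun z hz => (hsub hz).le
    _ ≤ ∫⁻ z in D, genPow m k * nearIntegral (D.indicator F) k k z ∂(haar m) :=
      setLIntegral_mono' hD fun z hz => mul_le_mul_right (nearIntegral_mono fun t ht => by
        rw [Set.indicator_of_mem (hcongr z t ht hz)]) _
    _ ≤ ∫⁻ z, genPow m k * nearIntegral (D.indicator F) k k z ∂(haar m) :=
      setLIntegral_le_lintegral _ _
    _ = ∫⁻ t in D, F t ∂(haar m) := by
      have hFD := hF.indicator hD
      rw [lintegral_const_mul _ (measurable_nearIntegral hm hFD k k),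
        lintegral_nearIntegral hm hFD]
      simp only [haar_near hm]
      rw [lintegral_mul_const _ hFD, mul_left_comm, genPow_mul_inv hm, mul_one,
        lintegral_indicator hD]

/-- Doob's maximal inequality for the dyadic-type filtration of the Vilenkin group. -/
theorem mul_haar_iUnion_exceed_le (hm : ∀ k, 2 ≤ m k) (hF : Measurable F) :
    y * haar m (⋃ k, exceed F y k) ≤ ∫⁻ t, F t ∂(haar m) := by
  -- `D k` is the set of points whose first passage above `y` happens at level `k`; it depends only
  -- on the first `k` coordinates.
  set D : ℕ → Set (Grp m) := disjointed (exceed F y) with hD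
  have hmeas : ∀ k, MeasurableSet (D k) := MeasurableSet.disjointed (measurableSet_exceed hm hF)
  have hmem : ∀ k z, z ∈ D k ↔ z ∈ exceed F y k ∧ ∀ i < k, z ∉ exceed F y i := fun k z => by
    simp [hD, disjointed_apply]
  have hdisj : Pairwise (Function.onFun Disjoint D) := disjoint_disjointed _
  have hU : ⋃ k, exceed F y k = ⋃ k, D k := (iUnion_disjointed (f := exceed F y)).symm
  rw [hU, measure_iUnion hdisj hmeas, ← ENNReal.tsum_mul_left]
  calc _ ≤ ∑' k, ∫⁻ t in D k, F t ∂(haar m) := ENNReal.tsum_le_tsum fun k =>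
        mul_haar_le_of_subset_exceed hm hF (hmeas k) (fun z hz => ((hmem k z).1 hz).1)
          fun x z h hx => by
            rw [hmem] at hx ⊢
            exact ⟨(mem_exceed_congr h).1 hx.1, fun i hi =>
              (mem_exceed_congr (h.initial le_rfl hi.le)).not.1 (hx.2 i hi)⟩
    _ = ∫⁻ t in ⋃ k, D k, F t ∂(haar m) := (lintegral_iUnion hmeas hdisj _).symm
    _ ≤ _ := setLIntegral_le_lintegral _ _

/-- The part of the maximal function that comes from the points where the martingale of `F` has
been stopped. -/
noncomputable def stoppedSum (F : Grp m → ℝ≥0∞) (y : ℝ≥0∞) (x : Grp m) : ℝ≥0∞ :=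
  ∑' s, ∑ j ∈ Finset.range (s + 1),
    genPow m j * nearIntegral ((stopped F y s \ stopped F y j).indicator F) s j x

/-- If `t` is first stopped at level `k`, only `j < k ≤ s` contribute. The sum over `j` is at most
`M_k / M_s`, and `M_{k+i} ≥ 2^i M_k` leaves a geometric series. -/
theorem tsum_stopped_le (hm : ∀ k, 2 ≤ m k) (t : Grp m) :
    ∑' s, ∑ j ∈ Finset.range (s + 1), (genPow m j : ℝ≥0∞) * ((genPow m s : ℝ≥0∞)⁻¹ *
      (stopped F y s \ stopped F y j).indicator 1 t) ≤ 2 := by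
  classical
  by_cases hex : ∃ k, t ∈ stopped F y k
  swap
  · have : ∀ s j, (stopped F y s \ stopped F y j).indicator (1 : Grp m → ℝ≥0∞) t = 0 :=
      fun s j => Set.indicator_of_notMem (fun h => hex ⟨s, h.1⟩) _
    simp [this]
  set k := Nat.find hex with hk
  have hlt : ∀ j, t ∉ stopped F y j → j < k := fun j hj =>
    not_le.1 fun h => hj (stopped_mono h (Nat.find_spec hex))
  have hge : ∀ s, t ∈ stopped F y s → k ≤ s := fun s hs => Nat.find_min' hex hs
  have hterm : ∀ s, ∑ j ∈ Finset.range (s + 1), (genPow m j : ℝ≥0∞) *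
      ((genPow m s : ℝ≥0∞)⁻¹ * (stopped F y s \ stopped F y j).indicator 1 t) ≤
      if k ≤ s then (genPow m k : ℝ≥0∞) * (genPow m s : ℝ≥0∞)⁻¹ else 0 := by
    intro s
    split_ifs with hks
    · calc _ ≤ ∑ j ∈ Finset.range (s + 1),
            if j < k then (genPow m j : ℝ≥0∞) * (genPow m s : ℝ≥0∞)⁻¹ else 0 := by
            refine Finset.sum_le_sum fun j _ => ?_
            split_ifs with hj
            · gcongr
              refine mul_le_of_le_one_right' ?_
              exact Set.indicator_le_self' (by simp) _
            · rw [Set.indicator_of_notMem fun h => hj (hlt j h.2)]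
              simp
        _ ≤ ∑ j ∈ Finset.range k, (genPow m j : ℝ≥0∞) * (genPow m s : ℝ≥0∞)⁻¹ := by
            rw [← Finset.sum_filter]
            exact Finset.sum_le_sum_of_subset fun j hj => by simp at hj ⊢; exact hj.2
        _ ≤ _ := by
            rw [← Finset.sum_mul]
            gcongr
            exact_mod_cast sum_genPow_le hm k
    · refine (Finset.sum_eq_zero fun j _ => ?_).le
      rw [Set.indicator_of_notMem fun h => hks (hge s h.1)]
      simp
  have hpow : ∀ i, (genPow m k : ℝ≥0∞) * (genPow m (i + k) : ℝ≥0∞)⁻¹ ≤ 2⁻¹ ^ i := by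
    intro i
    have h : (2 : ℝ≥0∞) ^ i * genPow m k ≤ genPow m (i + k) := by
      induction i with
      | zero => simp
      | succ i ih =>
        calc _ = 2 * ((2 : ℝ≥0∞) ^ i * genPow m k) := by ring
          _ ≤ 2 * genPow m (i + k) := by gcongr
          _ ≤ _ := by
            rw [add_right_comm]
            exact_mod_cast two_mul_genPow_le hm (i + k)
    refine ENNReal.div_le_of_le_mul ?_
    calc (genPow m k : ℝ≥0∞) = 2⁻¹ ^ i * 2 ^ i * genPow m k := by
          rw [← mul_pow, ENNReal.inv_mul_cancel (by simp) (by simp), one_pow, one_mul]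
      _ ≤ _ := by rw [mul_assoc]; gcongr
  calc _ ≤ ∑' s, if k ≤ s then (genPow m k : ℝ≥0∞) * (genPow m s : ℝ≥0∞)⁻¹ else 0 :=
        ENNReal.tsum_le_tsum hterm
    _ = ∑' i, (genPow m k : ℝ≥0∞) * (genPow m (i + k) : ℝ≥0∞)⁻¹ := by
        rw [← ENNReal.summable.sum_add_tsum_nat_add' (k := k), Finset.sum_eq_zero, zero_add]
        · simp
        · intro s hs
          rw [if_neg (by simpa using hs)]
    _ ≤ ∑' i, 2⁻¹ ^ i := ENNReal.tsum_le_tsum hpow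
    _ = 2 := by rw [ENNReal.tsum_geometric, ENNReal.one_sub_inv_two, inv_inv]

theorem measurable_stoppedSum (hm : ∀ k, 2 ≤ m k) (hF : Measurable F) :
    Measurable (stoppedSum F y) :=
  .tsum fun s => Finset.measurable_sum _ fun j _ =>
    (measurable_nearIntegral hm (hF.indicator ((measurableSet_stopped hm hF s).diff
      (measurableSet_stopped hm hF j))) s j).const_mul _

/-- Tonelli moves the `x`-integration onto the neighbourhoods, of measure at most `B / M_s`; what
multiplies `B F(t)` is then the sum in `tsum_stopped_le`. -/
theorem lintegral_stoppedSum_le {B : ℕ} (hm : ∀ k, 2 ≤ m k) (hB : ∀ k, m k ≤ B)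
    (hF : Measurable F) :
    ∫⁻ x, stoppedSum F y x ∂(haar m) ≤ 2 * B * ∫⁻ t, F t ∂(haar m) := by
  have hS : ∀ s j, MeasurableSet (stopped F y s \ stopped F y j) := fun s j =>
    (measurableSet_stopped hm hF s).diff (measurableSet_stopped hm hF j)
  have hFS : ∀ s j, Measurable ((stopped F y s \ stopped F y j).indicator F) := fun s j =>
    hF.indicator (hS s j)
  have hmeas : ∀ s j, Measurable fun x => (genPow m j : ℝ≥0∞) *
      nearIntegral ((stopped F y s \ stopped F y j).indicator F) s j x := fun s j =>
    (measurable_nearIntegral hm (hFS s j) s j).const_mul _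
  have hone : ∀ s j, Measurable fun t => (genPow m j : ℝ≥0∞) * ((genPow m s : ℝ≥0∞)⁻¹ *
      (stopped F y s \ stopped F y j).indicator 1 t) := fun s j =>
    ((measurable_one.indicator (hS s j)).const_mul _).const_mul _
  have hprod : ∀ s j, Measurable fun t => B * F t * ((genPow m j : ℝ≥0∞) *
      ((genPow m s : ℝ≥0∞)⁻¹ * (stopped F y s \ stopped F y j).indicator 1 t)) := fun s j =>
    (hF.const_mul _).mul (hone s j)
  have hsum : ∀ s, Measurable fun t => B * F t * ∑ j ∈ Finset.range (s + 1),
      ((genPow m j : ℝ≥0∞) * ((genPow m s : ℝ≥0∞)⁻¹ *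
      (stopped F y s \ stopped F y j).indicator 1 t)) := fun s =>
    (hF.const_mul _).mul (Finset.measurable_sum _ fun j _ => hone s j)
  have hterm : ∀ s j, ∫⁻ x, (genPow m j : ℝ≥0∞) *
      nearIntegral ((stopped F y s \ stopped F y j).indicator F) s j x ∂(haar m) ≤
      ∫⁻ t, B * F t * ((genPow m j : ℝ≥0∞) * ((genPow m s : ℝ≥0∞)⁻¹ *
      (stopped F y s \ stopped F y j).indicator 1 t)) ∂(haar m) := by
    intro s j
    rw [lintegral_const_mul _ (measurable_nearIntegral hm (hFS s j) s j),
      lintegral_nearIntegral hm (hFS s j),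
      ← lintegral_const_mul' _ _ (by simp)]
    refine lintegral_mono fun t => ?_
    by_cases ht : t ∈ stopped F y s \ stopped F y j
    · simp only [Set.indicator_of_mem ht, Pi.one_apply, mul_one]
      calc _ ≤ (genPow m j : ℝ≥0∞) * (F t * (B * (genPow m s : ℝ≥0∞)⁻¹)) := by
            gcongr; exact haar_near_le hm hB s j t
        _ = _ := by ring
    · simp [Set.indicator_of_notMem ht]
  unfold stoppedSum
  rw [lintegral_tsum fun s => (Finset.measurable_sum _ fun j _ => hmeas s j).aemeasurable]
  calc _ ≤ ∑' s, ∫⁻ t, B * F t * ∑ j ∈ Finset.range (s + 1),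
        ((genPow m j : ℝ≥0∞) * ((genPow m s : ℝ≥0∞)⁻¹ *
        (stopped F y s \ stopped F y j).indicator 1 t)) ∂(haar m) := by
        refine ENNReal.tsum_le_tsum fun s => ?_
        rw [lintegral_finsetSum _ fun j _ => hmeas s j]
        simp only [Finset.mul_sum]
        rw [lintegral_finsetSum _ fun j _ => hprod s j]
        exact Finset.sum_le_sum fun j _ => hterm s j
    _ = ∫⁻ t, B * F t * ∑' s, ∑ j ∈ Finset.range (s + 1),
        ((genPow m j : ℝ≥0∞) * ((genPow m s : ℝ≥0∞)⁻¹ *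
        (stopped F y s \ stopped F y j).indicator 1 t)) ∂(haar m) := by
        rw [← lintegral_tsum fun s => (hsum s).aemeasurable]
        simp only [ENNReal.tsum_mul_left]
    _ ≤ ∫⁻ t, 2 * B * F t ∂(haar m) := by
        refine lintegral_mono fun t => ?_
        calc _ ≤ B * F t * 2 := by gcongr; exact tsum_stopped_le hm t
          _ = _ := by ring
    _ = _ := lintegral_const_mul _ hF

/-- The positive operators that majorize the Fejér means. -/
noncomputable def nearMean (F : Grp m → ℝ≥0∞) (s : ℕ) (x : Grp m) : ℝ≥0∞ :=
  ∑ j ∈ Finset.range (s + 1), genPow m j * nearIntegral F s j x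

/-- Being stopped by level `s` is constant on cylinders of level `s`: either the integrand vanishes
on the whole cylinder, or the average of `F` there is at most `y`. -/
theorem nearIntegral_indicator_compl_le (s : ℕ) (hm : ∀ k, 2 ≤ m k) (z : Grp m) :
    nearIntegral ((stopped F y s)ᶜ.indicator F) s s z ≤ y * (genPow m s : ℝ≥0∞)⁻¹ := by
  by_cases hz : z ∈ stopped F y s
  · refine (nearIntegral_mono (G := 0) fun t ht => ?_).trans (by simp [nearIntegral])
    rw [Set.indicator_of_notMem (by simpa using (mem_stopped_congr ht).1 hz)]
    exact le_rfl
  · have h : genPow m s * nearIntegral F s s z ≤ y := not_lt.1 fun h => hz ⟨s, le_rfl, h⟩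
    refine (nearIntegral_mono (G := F) fun t _ => Set.indicator_le_self _ _ _).trans ?_
    rw [← div_eq_mul_inv, ENNReal.le_div_iff_mul_le (by simp [(genPow_pos hm s).ne']) (by simp)]
    rwa [mul_comm]

theorem nearMean_le {B : ℕ} (hm : ∀ k, 2 ≤ m k) (hB : ∀ k, m k ≤ B) (hF : Measurable F)
    {x : Grp m} (hx : ∀ k, x ∉ exceed F y k) (s : ℕ) :
    nearMean F s x ≤ 2 * B * y + stoppedSum F y x := by
  have hsplit : ∀ j ∈ Finset.range (s + 1), (genPow m j : ℝ≥0∞) * nearIntegral F s j x ≤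
      genPow m j * (B * (y * (genPow m s : ℝ≥0∞)⁻¹)) + genPow m j *
        nearIntegral ((stopped F y s \ stopped F y j).indicator F) s j x := by
    intro j hj
    have hjs : j ≤ s := Nat.lt_succ_iff.1 (Finset.mem_range.1 hj)
    rw [← mul_add]
    gcongr
    calc nearIntegral F s j x
        ≤ nearIntegral ((stopped F y s)ᶜ.indicator F +
          (stopped F y s \ stopped F y j).indicator F) s j x := by
          refine nearIntegral_mono fun t ht => ?_
          -- The exempt coordinate is the `j`-th, so `t` and `x` agree on all coordinates below `j`,
          -- and `x` is never stopped.
          have htj : t ∉ stopped F y j := fun h => by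
            obtain ⟨i, _, hi⟩ := (mem_stopped_congr (ht.initial hjs le_rfl)).2 h
            exact hx i hi
          by_cases hts : t ∈ stopped F y s <;> simp [hts, htj]
      _ = nearIntegral ((stopped F y s)ᶜ.indicator F) s j x +
          nearIntegral ((stopped F y s \ stopped F y j).indicator F) s j x :=
          lintegral_add_left (hF.indicator (measurableSet_stopped hm hF s).compl) _
      _ ≤ _ := by
          gcongr
          exact nearIntegral_le_of_forall hm hB (nearIntegral_indicator_compl_le s hm) j x
  refine (Finset.sum_le_sum hsplit).trans ?_
  rw [Finset.sum_add_distrib]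
  refine add_le_add ?_ (ENNReal.le_tsum s)
  rw [← Finset.sum_mul]
  have hsum : ∑ j ∈ Finset.range (s + 1), genPow m j ≤ 2 * genPow m s := by
    rw [Finset.sum_range_succ]
    have := sum_genPow_le hm s
    omega
  calc _ ≤ (2 * genPow m s : ℝ≥0∞) * (B * (y * (genPow m s : ℝ≥0∞)⁻¹)) := by
        gcongr; exact_mod_cast hsum
    _ = 2 * B * y * (genPow m s * (genPow m s : ℝ≥0∞)⁻¹) := by ring
    _ = _ := by rw [genPow_mul_inv hm, mul_one]

theorem mul_haar_iSup_nearMean_le {B : ℕ} (hm : ∀ k, 2 ≤ m k) (hB : ∀ k, m k ≤ B)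
    (hF : Measurable F) :
    y * haar m {x | 4 * B * y < ⨆ s, nearMean F s x} ≤ 2 * ∫⁻ t, F t ∂(haar m) := by
  have hB0 : (2 * B : ℝ≥0∞) ≠ 0 := by
    have := (hm 0).trans (hB 0)
    have : B ≠ 0 := by omega
    simpa using this
  have hBt : (2 * B : ℝ≥0∞) ≠ ∞ := ENNReal.mul_ne_top (by simp) (by simp)
  -- Half of `4By` absorbs the unstopped part in `nearMean_le`; the other half is the Markov
  -- threshold for `stoppedSum`.
  have hsub : {x | 4 * B * y < ⨆ s, nearMean F s x} ⊆
      (⋃ k, exceed F y k) ∪ {x | 2 * B * y ≤ stoppedSum F y x} := by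
    intro x hx
    by_contra hcon
    simp only [Set.mem_union, Set.mem_iUnion, not_or, not_exists, Set.mem_ofPred_eq,
      not_le] at hcon
    refine hx.not_ge (iSup_le fun s => (nearMean_le hm hB hF hcon.1 s).trans ?_)
    calc _ ≤ 2 * B * y + 2 * B * y := by gcongr; exact hcon.2.le
      _ = _ := by ring
  have hmarkov : y * haar m {x | 2 * B * y ≤ stoppedSum F y x} ≤ ∫⁻ t, F t ∂(haar m) := by
    rw [← ENNReal.mul_le_mul_iff_right hB0 hBt, ← mul_assoc]
    exact (mul_meas_ge_le_lintegral (measurable_stoppedSum hm hF) _).trans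
      (lintegral_stoppedSum_le hm hB hF)
  calc _ ≤ y * (haar m (⋃ k, exceed F y k) + haar m {x | 2 * B * y ≤ stoppedSum F y x}) := by
        gcongr; exact (measure_mono hsub).trans (measure_union_le _ _)
    _ ≤ _ := by
        rw [mul_add, two_mul (∫⁻ t, F t ∂(haar m))]
        exact add_le_add (mul_haar_iUnion_exceed_le hm hF) hmarkov

end Maximal

/-! ### Integral representation and domination of the Fejér means. -/

section Kernel

variable {m : ℕ → ℕ}

/-- The values `r_k(x) \overline{r_k(t)}`. -/
noncomputable def ratio (m : ℕ → ℕ) (x t : Grp m) (k : ℕ) : ℂ :=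
  rademacher m k x * (starRingEnd ℂ) (rademacher m k t)

theorem rademacher_eq_toCircle (k : ℕ) [NeZero (m k)] (x : Grp m) :
    rademacher m k x = ZMod.toCircle (x k) := by
  rw [rademacher, ZMod.toCircle_apply]

theorem rademacher_pow (hm : ∀ k, 2 ≤ m k) (k : ℕ) (x : Grp m) : rademacher m k x ^ m k = 1 := by
  have : NeZero (m k) := ⟨by have := hm k; omega⟩
  rw [rademacher_eq_toCircle, ← Circle.coe_pow, ← AddChar.map_nsmul_eq_pow]
  simp

theorem norm_rademacher (hm : ∀ k, 2 ≤ m k) (k : ℕ) (x : Grp m) : ‖rademacher m k x‖ = 1 :=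
  norm_eq_one_of_pow hm (w := fun k => rademacher m k x) (fun k => rademacher_pow hm k x) k

theorem ratio_pow (hm : ∀ k, 2 ≤ m k) (x t : Grp m) (k : ℕ) : ratio m x t k ^ m k = 1 := by
  rw [ratio, mul_pow, ← map_pow, rademacher_pow hm, rademacher_pow hm, map_one, mul_one]

/-- The Rademacher functions are unimodular and separate the points of each factor; this turns
conditions on `w` into nearness of `x` and `t`. -/
theorem eq_of_ratio_eq_one (hm : ∀ k, 2 ≤ m k) {x t : Grp m} {k : ℕ} (h : ratio m x t k = 1) :
    x k = t k := by
  have : NeZero (m k) := ⟨by have := hm k; omega⟩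
  have h1 : rademacher m k x = rademacher m k t := by
    have ht : (starRingEnd ℂ) (rademacher m k t) * rademacher m k t = 1 := by
      rw [← Complex.normSq_eq_conj_mul_self, Complex.normSq_eq_norm_sq, norm_rademacher hm]
      simp
    rw [← mul_one (rademacher m k x), ← ht, ← mul_assoc]
    exact (congrArg (· * rademacher m k t) h).trans (one_mul _)
  rw [rademacher_eq_toCircle, rademacher_eq_toCircle] at h1
  exact ZMod.injective_toCircle (Circle.coe_injective h1)

theorem psi_mul_conj_psi (n : ℕ) (x t : Grp m) :
    psi m n x * (starRingEnd ℂ) (psi m n t) = character m (ratio m x t) n := by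
  simp only [psi, character, ratio, map_prod, map_pow, ← Finset.prod_mul_distrib, mul_pow]

theorem norm_psi (hm : ∀ k, 2 ≤ m k) (n : ℕ) (x : Grp m) : ‖psi m n x‖ = 1 := by
  simp [psi, norm_prod, norm_rademacher hm]

theorem measurable_psi (n : ℕ) : Measurable (psi m n) := by
  refine Finset.measurable_prod _ fun k _ => Measurable.pow_const ?_ _
  exact (measurable_from_top (f := fun a : ZMod (m k) =>
    Complex.exp (2 * Real.pi * Complex.I * (a.val : ℂ) / (m k : ℂ)))).comp (measurable_pi_apply k)

theorem integrable_mul_conj_psi (hm : ∀ k, 2 ≤ m k) {f : Grp m → ℂ}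
    (hf : Integrable f (haar m)) (n : ℕ) :
    Integrable (fun t => f t * (starRingEnd ℂ) (psi m n t)) (haar m) :=
  hf.mul_bdd (c := 1)
    (Complex.continuous_conj.measurable.comp (measurable_psi n)).aestronglyMeasurable
    (.of_forall fun t => by simp [norm_psi hm])

theorem partialSum_eq_integral (hm : ∀ k, 2 ≤ m k) {f : Grp m → ℂ}
    (hf : Integrable f (haar m)) (n : ℕ) (x : Grp m) :
    Integrable (fun t => f t * dirichlet m (ratio m x t) n) (haar m) ∧
      partialSum m f n x = ∫ t, f t * dirichlet m (ratio m x t) n ∂(haar m) := by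
  have h : ∀ k t, f t * character m (ratio m x t) k =
      psi m k x * (f t * (starRingEnd ℂ) (psi m k t)) := fun k t => by
    rw [← psi_mul_conj_psi]; ring
  have hi : ∀ k, Integrable (fun t => f t * character m (ratio m x t) k) (haar m) := fun k => by
    simp only [h]
    exact (integrable_mul_conj_psi hm hf k).const_mul _
  simp only [dirichlet, Finset.mul_sum]
  refine ⟨integrable_finsetSum _ fun k _ => hi k, ?_⟩
  rw [integral_finsetSum _ fun k _ => hi k]
  refine Finset.sum_congr rfl fun k _ => ?_
  simp only [h]
  rw [integral_const_mul, fourierCoeff, mul_comm]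

theorem fejerMean_eq_integral (hm : ∀ k, 2 ≤ m k) {f : Grp m → ℂ}
    (hf : Integrable f (haar m)) (n : ℕ) (x : Grp m) :
    fejerMean m f n x = (1 / (n : ℂ)) * ∫ t, f t * fejerSum m (ratio m x t) n ∂(haar m) := by
  simp only [fejerMean, fejerSum, Finset.mul_sum]
  rw [integral_finsetSum _ fun k _ => (partialSum_eq_integral hm hf k x).1, Finset.mul_sum]
  exact Finset.sum_congr rfl fun k _ => by rw [(partialSum_eq_integral hm hf k x).2]

theorem enorm_fejerSum_ratio_le {B : ℕ} (hm : ∀ k, 2 ≤ m k) (hB : ∀ k, m k ≤ B) {n N : ℕ}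
    (hN : N < genPow m n) (x t : Grp m) :
    ‖fejerSum m (ratio m x t) N‖ₑ ≤ 3 * B ^ 3 * ∑ s ∈ Finset.range n,
      ∑ j ∈ Finset.range (s + 1), (genPow m j : ℝ≥0∞) * genPow m s *
        {t | near s j x t}.indicator 1 t := by
  have hind : ∀ s j, ENNReal.ofReal (offInd (ratio m x t) s j) ≤
      {t | near s j x t}.indicator 1 t := by
    intro s j
    by_cases h : ∀ i < s, i ≠ j → ratio m x t i = 1
    · have : near s j x t := fun i hi hj => eq_of_ratio_eq_one hm (h i hi hj)
      rw [offInd, if_pos h, Set.indicator_of_mem (by exact this)]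
      simp
    · rw [offInd, if_neg h]
      simp
  have h := ENNReal.ofReal_le_ofReal (norm_fejerSum_le hm hB (ratio_pow hm x t) hN)
  rw [ofReal_norm, ENNReal.ofReal_mul (by positivity),
    ENNReal.ofReal_sum_of_nonneg fun s _ => majorant_nonneg m _ s] at h
  refine h.trans (mul_le_mul' (le_of_eq ?_) (Finset.sum_le_sum fun s _ => ?_))
  · rw [ENNReal.ofReal_mul (by simp), ENNReal.ofReal_pow (by simp)]
    simp
  · rw [majorant, ENNReal.ofReal_sum_of_nonneg fun j _ =>
      mul_nonneg (by positivity) (offInd_nonneg _ _ _)]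
    refine Finset.sum_le_sum fun j _ => ?_
    rw [ENNReal.ofReal_mul (by positivity), ENNReal.ofReal_mul (by positivity),
      ENNReal.ofReal_natCast, ENNReal.ofReal_natCast]
    gcongr
    exact hind s j

theorem enorm_fejerMean_le {B : ℕ} (hm : ∀ k, 2 ≤ m k) (hB : ∀ k, m k ≤ B) {f : Grp m → ℂ}
    (hf : Integrable f (haar m)) {F : Grp m → ℝ≥0∞} (hF : Measurable F)
    (hfF : ∀ᵐ t ∂(haar m), ‖f t‖ₑ = F t) {N : ℕ} (hN : 1 ≤ N) (x : Grp m) :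
    ‖fejerMean m f N x‖ₑ ≤ 6 * B ^ 3 * ⨆ s, nearMean F s x := by
  obtain ⟨n, hn, hn'⟩ := exists_genPow_le_lt hm hN
  have hF1 : ∀ s j, Measurable fun t => (genPow m j : ℝ≥0∞) *
      {t | near s j x t}.indicator F t := fun s j =>
    (hF.indicator (measurableSet_near_right s j x)).const_mul _
  have hF2 : ∀ s, Measurable fun t => (genPow m s : ℝ≥0∞) * ∑ j ∈ Finset.range (s + 1),
      (genPow m j : ℝ≥0∞) * {t | near s j x t}.indicator F t := fun s =>
    (Finset.measurable_sum _ fun j _ => hF1 s j).const_mul _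
  have hint : ‖∫ t, f t * fejerSum m (ratio m x t) N ∂(haar m)‖ₑ ≤
      3 * B ^ 3 * ∑ s ∈ Finset.range (n + 1), genPow m s * nearMean F s x := by
    calc _ ≤ ∫⁻ t, ‖f t * fejerSum m (ratio m x t) N‖ₑ ∂(haar m) :=
          enorm_integral_le_lintegral_enorm _
      _ ≤ ∫⁻ t, 3 * B ^ 3 * ∑ s ∈ Finset.range (n + 1), genPow m s *
            ∑ j ∈ Finset.range (s + 1), (genPow m j : ℝ≥0∞) *
              {t | near s j x t}.indicator F t ∂(haar m) := by
          refine lintegral_mono_ae (hfF.mono fun t ht => ?_)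
          rw [enorm_mul, ht]
          refine (mul_le_mul_right (enorm_fejerSum_ratio_le hm hB hn' x t) _).trans_eq ?_
          rw [mul_left_comm]
          congr 1
          simp only [Finset.mul_sum]
          refine Finset.sum_congr rfl fun s _ => Finset.sum_congr rfl fun j _ => ?_
          by_cases h : t ∈ {t | near s j x t}
          · simp only [Set.indicator_of_mem h, Pi.one_apply]; ring
          · simp only [Set.indicator_of_notMem h]; ring
      _ = _ := by
          rw [lintegral_const_mul _ (Finset.measurable_sum _ fun s _ => hF2 s),
            lintegral_finsetSum _ fun s _ => hF2 s]
          congr 1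
          refine Finset.sum_congr rfl fun s _ => ?_
          rw [lintegral_const_mul _ (Finset.measurable_sum _ fun j _ => hF1 s j),
            lintegral_finsetSum _ fun j _ => hF1 s j, nearMean]
          congr 1
          refine Finset.sum_congr rfl fun j _ => ?_
          rw [lintegral_const_mul _ (hF.indicator (measurableSet_near_right s j x)),
            nearIntegral_eq]
  have hN0 : (N : ℂ) ≠ 0 := by exact_mod_cast (by omega : N ≠ 0)
  -- The sum below `n` is at most `M_n`, and `M_n ≤ N`; the factor `2` turns the kernel constant `3
  -- B^3` into `6 B^3`.
  have hsum : ∑ s ∈ Finset.range (n + 1), genPow m s ≤ 2 * N := by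
    rw [Finset.sum_range_succ]
    have := sum_genPow_le hm n
    omega
  rw [fejerMean_eq_integral hm hf, enorm_mul, one_div, enorm_inv hN0]
  have hNe : ‖(N : ℂ)‖ₑ = N := by rw [← ofReal_norm]; simp
  rw [hNe]
  calc _ ≤ (N : ℝ≥0∞)⁻¹ * (3 * B ^ 3 *
        ∑ s ∈ Finset.range (n + 1), genPow m s * ⨆ s, nearMean F s x) := by
        refine mul_le_mul_right (hint.trans ?_) _
        gcongr with s
        exact le_iSup (fun s => nearMean F s x) s
    _ ≤ (N : ℝ≥0∞)⁻¹ * (3 * B ^ 3 * ((2 * N : ℝ≥0∞) * ⨆ s, nearMean F s x)) := by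
        rw [← Finset.sum_mul]
        gcongr
        exact_mod_cast hsum
    _ = (N : ℝ≥0∞)⁻¹ * N * (6 * B ^ 3 * ⨆ s, nearMean F s x) := by ring
    _ = _ := by
        rw [ENNReal.inv_mul_cancel (by exact_mod_cast (by omega : N ≠ 0)) (by simp), one_mul]

end Kernel

end Vilenkin

/-! ### The weak type estimate. -/

/-- On a bounded Vilenkin group, the maximal operator of the Vilenkin–Fejér means is of weak
type `(1, 1)`. -/
theorem mainTheorem5 (m : ℕ → ℕ) (hm : ∀ k, 2 ≤ m k) (hb : BddAbove (Set.range m)) :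
    ∃ C : ℝ≥0∞, C ≠ ∞ ∧ ∀ f : Vilenkin.Grp m → ℂ, Integrable f (Vilenkin.haar m) →
      ⨆ (y : ℝ) (_ : 0 < y),
          ENNReal.ofReal y *
            Vilenkin.haar m {x | ENNReal.ofReal y < Vilenkin.maximalFejer m f x}
        ≤ C * eLpNorm f 1 (Vilenkin.haar m) := by
  obtain ⟨B, hB⟩ := hb
  replace hB : ∀ k, m k ≤ B := fun k => hB ⟨k, rfl⟩
  have hB0 : B ≠ 0 := by have := (hm 0).trans (hB 0); omega
  -- `6 B^3` from the domination, `4 B` from the threshold and `2` from the weak type bound for the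
  -- positive operators.
  refine ⟨48 * B ^ 4, ENNReal.mul_ne_top (by simp) (ENNReal.pow_ne_top (by simp)),
    fun f hf => iSup₂_le fun y hy => ?_⟩
  -- The stopping argument needs a truly measurable `F`, so `f` is replaced by a measurable
  -- representative.
  have hF : Measurable fun t => ‖hf.1.mk f t‖ₑ := hf.1.stronglyMeasurable_mk.measurable.enorm
  have hfF : ∀ᵐ t ∂(Vilenkin.haar m), ‖f t‖ₑ = ‖hf.1.mk f t‖ₑ :=
    hf.1.ae_eq_mk.mono fun t ht => by rw [← ht]
  set F : Vilenkin.Grp m → ℝ≥0∞ := fun t => ‖hf.1.mk f t‖ₑ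
  have hK0 : (24 * B ^ 4 : ℝ≥0∞) ≠ 0 := by simp [hB0]
  have hKt : (24 * B ^ 4 : ℝ≥0∞) ≠ ∞ :=
    ENNReal.mul_ne_top (by simp) (ENNReal.pow_ne_top (by simp))
  obtain ⟨c, hyc⟩ : ∃ c : ℝ≥0∞, ENNReal.ofReal y = 24 * B ^ 4 * c :=
    ⟨ENNReal.ofReal y / (24 * B ^ 4), (ENNReal.mul_div_cancel hK0 hKt).symm⟩
  have hsub : {x | ENNReal.ofReal y < Vilenkin.maximalFejer m f x} ⊆
      {x | 4 * B * c < ⨆ s, Vilenkin.nearMean F s x} := by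
    intro x hx
    by_contra hcon
    refine hx.not_ge (iSup₂_le fun N hN =>
      (Vilenkin.enorm_fejerMean_le hm hB hf hF hfF hN x).trans ?_)
    rw [hyc]
    calc _ ≤ 6 * (B : ℝ≥0∞) ^ 3 * (4 * B * c) := by gcongr; exact not_lt.1 hcon
      _ = _ := by ring
  calc _ ≤ 24 * B ^ 4 * (c * Vilenkin.haar m {x | 4 * B * c < ⨆ s, Vilenkin.nearMean F s x}) := by
        -- Only the outer factor is to be expressed through `c`; the last rewrite restores the level
        -- inside the set, so that `hsub` applies.
        rw [hyc, mul_assoc, ← hyc]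
        gcongr
    _ ≤ 24 * B ^ 4 * (2 * ∫⁻ t, F t ∂(Vilenkin.haar m)) := by
        exact mul_le_mul_right (Vilenkin.mul_haar_iSup_nearMean_le hm hB hF) _
    _ = 48 * B ^ 4 * ∫⁻ t, F t ∂(Vilenkin.haar m) := by ring
    _ = _ := by rw [eLpNorm_one_eq_lintegral_enorm, lintegral_congr_ae hfF]
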